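/- Let $N>k\ge 1$ be integers, $\mathcal A=\{1,\dots,N\}$, let $X=\mathcal A^{\mathbb N}$ be the one-sided full shift with left shift $S$, and let $\mu$ be the uniform Bernoulli measure on $X$. For a set $\mathcal K$ of words of length $n$, let $H(\mathcal K)\subseteq X$ be the set of sequences that start with a word of $\mathcal K$, let $\Omega_m(\mathcal K)=\{x\in X: S^i x\notin H(\mathcal K),\ 0\le i\le m-1\}$, let $$\rho(\mathcal K)=-\lim_{m\to\infty}\frac1m\ln\mu(\Omega_m(\mathcal K))$$ be the escape rate into $H(\mathcal K)$, and let $X_{\mathcal K}$ be the set of sequences in $X$ that contain no word of $\mathcal K$. For a shift-invariant $Y\subseteq X$, let $h(Y)=\lim_{m\to\infty}\frac1m\ln\#\mathcal L_m(Y)$ be the topological entropy, where $\mathcal L_m(Y)$ is the set of words of length $m$ that occur in sequences of $Y$. For two words $u,w$ of length $n$ let $(u,w)_z=\sum_{\ell=0}^{n-1}b_\ell z^\ell$ be their correlation polynomial, where $b_\ell=1$ if the overlapping parts of $u$ and $w$ coincide when the first symbol of $w$ is placed under the $(n-\ell)$-th symbol of $u$, and $b_\ell=0$ otherwise. For $n\ge1$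 let $\mathcal K_n$ be a set of exactly $k$ words of length $n$ such that the holes $H_n=H(\mathcal K_n)$ satisfy $H_1\supseteq H_2\supseteq\cdots$ and $\bigcap_{n\ge1}H_n=\{x_1,\dots,x_k\}$ with $x_1,\dots,x_k\in X$ pairwise distinct. Let $w_{i,n}$ be the prefix of $x_i$ of length $n$ and $\mathcal M_n(z)=[(w_{j,n},w_{i,n})_z]_{1\le i,j\le k}$. Then the limit $\alpha(N)=\lim_{n\to\infty}N^{-n}\mathcal M_n(N)$ exists and is an invertible matrix, the escape rates $\rho(\mathcal K_n)$ and the entropies $h(X)$ and $h(X_{\mathcal K_n})$ exist for all $n\ge1$, and the local escape rate into $x_1,\dots,x_k$ exists and is $$\rho(x_1,\dots,x_k)=\lim_{n\to\infty}\frac{\rho(\mathcal K_n)}{\mu(H_n)}=\lim_{n\to\infty}\frac{h(X)-h(X_{\mathcal K_n})}{kN^{-n}}=\frac{T}{kN},$$ where $T$ is the sum of the entries of $\alpha(N)^{-1}$. -/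

import Mathlib

open Filter Topology MeasureTheory

/-- The left shift on one-sided sequences. -/
def shift {A : Type*} (x : ℕ → A) : ℕ → A := fun i => x (i + 1)

/-- The word formed by the first `n` symbols of `x`. -/
def prefixWord {A : Type*} (n : ℕ) (x : ℕ → A) : Fin n → A := fun i => x i

/-- The hole `⋃_{w ∈ K} C_w`: the sequences that start with a word of `K`. -/
def hole {A : Type*} {n : ℕ} (K : Finset (Fin n → A)) : Set (ℕ → A) :=
  {x | prefixWord n x ∈ K}

/-- `Ω_m(K)`: the points that do not enter the hole at the times `0, …, m - 1`. -/
def avoidUpTo {A : Type*} {n : ℕ} (K : Finset (Fin n → A)) (m : ℕ) : Set (ℕ → A) :=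
  {x | ∀ i < m, shift^[i] x ∉ hole K}

/-- `X_K`: the sequences of the full shift that contain no word of `K` as a subword, that is,
that never enter the hole. -/
def perturbation {A : Type*} {n : ℕ} (K : Finset (Fin n → A)) : Set (ℕ → A) :=
  {x | ∀ i, shift^[i] x ∉ hole K}

/-- The words of length `m` that are subwords of some sequence in `X`. -/
def language {A : Type*} (X : Set (ℕ → A)) (m : ℕ) : Set (Fin m → A) :=
  {w | ∃ x ∈ X, ∃ i, prefixWord m (shift^[i] x) = w}

/-- The topological entropy `lim (1/m) ln #L_m(X)` exists and equals `h`. -/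
def HasEntropy {A : Type*} (X : Set (ℕ → A)) (h : ℝ) : Prop :=
  Tendsto (fun m : ℕ => (1 / (m : ℝ)) * Real.log ((language X m).ncard : ℝ)) atTop (𝓝 h)

/-- The uniform Bernoulli measure on the one-sided full shift on `N` symbols: the infinite product
of the uniform probability measures on the alphabet. -/
noncomputable def uniformMeasure (N : ℕ) : Measure (ℕ → Fin N) :=
  Measure.infinitePi fun _ : ℕ => ProbabilityTheory.uniformOn (Set.univ : Set (Fin N))

/-- The escape rate `-lim (1/m) ln μ(Ω_m(K))` exists and equals `r`. -/
def HasEscapeRate {N n : ℕ} (K : Finset (Fin n → Fin N)) (r : ℝ) : Prop :=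
  Tendsto (fun m : ℕ => -((1 / (m : ℝ)) * Real.log ((uniformMeasure N).real (avoidUpTo K m))))
    atTop (𝓝 r)

/-- The local escape rate `lim ρ(K_n) / μ(H_n)` exists and equals `r`; the rates `ρ(K_n)`, `n ≥ 1`,
are required to exist. -/
def HasLocalEscapeRate {N : ℕ} (K : (n : ℕ) → Finset (Fin n → Fin N)) (r : ℝ) : Prop :=
  ∃ ρ : ℕ → ℝ, (∀ n, 1 ≤ n → HasEscapeRate (K n) (ρ n)) ∧
    Tendsto (fun n => ρ n / (uniformMeasure N).real (hole (K n))) atTop (𝓝 r)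

open Classical in
/-- The correlation polynomial `(u, w)_z`. The coefficient of `z ^ l` is `1` if and only if `u` and
`w` agree on their overlap when the first symbol of `w` is placed under the `(n - l)`-th symbol
of `u`; with positions counted from `0`, the position `j` of `w` is then under the position
`i = (n - l - 1) + j` of `u`. -/
noncomputable def correlation {A : Type*} {n m : ℕ} (u : Fin n → A) (w : Fin m → A) :
    Polynomial ℝ :=
  ∑ l ∈ Finset.range n,
    if ∀ (i : Fin n) (j : Fin m), (i : ℕ) + l + 1 = n + j → u i = w j then Polynomial.X ^ l else 0

/-- The correlation matrix function `M_n(z) = [(w_{j,n}, w_{i,n})_z]_{i,j}`, where `w_{i,n}` is the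
prefix of length `n` of `x_i`. -/
noncomputable def correlationMatrix {A : Type*} {k : ℕ} (x : Fin k → ℕ → A) (n : ℕ) (z : ℝ) :
    Matrix (Fin k) (Fin k) ℝ :=
  Matrix.of fun i j => (correlation (prefixWord n (x j)) (prefixWord n (x i))).eval z

/-- `α(z) = lim z⁻ⁿ M_n(z)`: the limit exists and equals `α`. -/
def IsLimitCorrelation {A : Type*} {k : ℕ} (x : Fin k → ℕ → A) (z : ℝ)
    (α : Matrix (Fin k) (Fin k) ℝ) : Prop :=
  Tendsto (fun n : ℕ => (z ^ n)⁻¹ • correlationMatrix x n z) atTop (𝓝 α)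

/-! The proof is a Guibas–Odlyzko count followed by a perturbation estimate. Let `a m` count the
words of length `m` avoiding the `k` forbidden words `w i` of length `n`, and let `f i m` count
those whose first forbidden factor is `w i`, at the very end. Appending one letter gives `a (m+1) +
∑ f i (m+1) = N * a m`. Appending `w i` letter by letter until a forbidden word first appears
expresses `a m` through the `f j`, with correlation coefficients as weights.

Fekete's lemma gives a growth rate `lam` of `a`. Since `k < N`, avoiding words extend to infinite
avoiding sequences, so the entropy of the perturbation is `log lam` and the escape rate is `log N -
log lam`. For `z > lam` the generating functions `S`, `F i` at `z⁻¹` converge and satisfy `S - 1 + ∑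
F i = (N/z) S` and `M(z) F = (S/z) 1`. If `R` is the sum of the entries of `M(z)⁻¹`, eliminating `F`
yields `R - (N - z) = z / S`. Fekete's bound `lam ^ m ≤ a m` forces `S ≥ z / (z - lam)`, hence `0 ≤
R - (N - z) ≤ z - lam`. No root of a characteristic equation has to be located.

With `z = lam + N^(-2n)` this determines `N^n (N - lam)` up to `N^(-n)` as the sum of the entries of
`(N^(-n) M_n(z))⁻¹`. An a priori bound puts `z` within `1/n²` of `N`; then `N^(-n) M_n(z)` tends to
the limit matrix by dominated convergence, and diagonal dominance makes that limit invertible.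
Passing to logarithms divides the limit by `N`. -/

/-- The word `u` contains no word of `W` as a factor. -/
def Avoids {A : Type*} (W : Set (List A)) (u : List A) : Prop := ∀ w ∈ W, ¬ w <:+: u

/-- The words of length `m` that contain no word of `W`. -/
def avoiding {A : Type*} (W : Set (List A)) (m : ℕ) : Set (List A) :=
  {u | u.length = m ∧ Avoids W u}

/-- The words of length `m` that end with `w` and contain no word of `W` before. -/
def firstHit {A : Type*} (W : Set (List A)) (w : List A) (m : ℕ) : Set (List A) :=
  {u | u.length = m ∧ Avoids W u.dropLast ∧ w <:+ u}

/-! ### Counting identities for words avoiding a finite family -/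

section Words

variable {A : Type*} {W : Set (List A)}

theorem Avoids.of_infix {u v : List A} (h : Avoids W v) (huv : u <:+: v) : Avoids W u :=
  fun w hw hwu => h w hw (hwu.trans huv)

theorem not_avoids_concat {u : List A} {c : A} (hu : Avoids W u) (h : ¬ Avoids W (u ++ [c])) :
    ∃ w ∈ W, w <:+ u ++ [c] := by
  unfold Avoids at h
  push Not at h
  obtain ⟨w, hw, hi⟩ := h
  rcases List.infix_concat_iff.1 hi with h | h
  · exact ⟨w, hw, h⟩
  · exact absurd h (hu w hw)

theorem finite_avoiding [Finite A] (m : ℕ) : (avoiding W m).Finite :=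
  (List.finite_length_eq A m).subset fun _ h => h.1

theorem firstHit_eq_empty {w : List A} {m : ℕ} (h : m < w.length) : firstHit W w m = ∅ := by
  ext u
  simp only [firstHit, Set.mem_ofPred_eq, Set.mem_empty_iff_false, iff_false]
  rintro ⟨h1, -, h2⟩
  have := h2.length_le
  omega

theorem avoiding_zero (hW : ∀ w ∈ W, w ≠ []) : avoiding W 0 = {[]} := by
  ext u
  simp only [avoiding, Set.mem_ofPred_eq, List.length_eq_zero_iff, Set.mem_singleton_iff]
  refine ⟨fun h => h.1, ?_⟩
  rintro rfl
  exact ⟨rfl, fun w hw h => hW w hw (List.infix_nil.1 h)⟩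

theorem ncard_avoiding_add_le [Finite A] (m l : ℕ) :
    (avoiding W (m + l)).ncard ≤ (avoiding W m).ncard * (avoiding W l).ncard := by
  rw [← Set.ncard_prod]
  refine Set.ncard_le_ncard_of_injOn (fun u => (u.take m, u.drop m)) ?_ ?_
    ((finite_avoiding m).prod (finite_avoiding l))
  · rintro u ⟨h1, h2⟩
    refine ⟨⟨by simp [h1], h2.of_infix (List.take_prefix m u).isInfix⟩,
      ⟨by simp [h1], h2.of_infix (List.drop_suffix m u).isInfix⟩⟩
  · intro u _ v _ h
    simp only [Prod.mk.injEq] at h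
    rw [← List.take_append_drop m u, ← List.take_append_drop m v, h.1, h.2]

theorem ncard_length_eq (A : Type*) [Fintype A] (m : ℕ) :
    {u : List A | u.length = m}.ncard = Fintype.card A ^ m := by
  rw [← Nat.card_coe_set_eq]
  change Nat.card (List.Vector A m) = _
  rw [Nat.card_eq_fintype_card, card_vector]

theorem ncard_avoiding_le [Fintype A] (m : ℕ) :
    (avoiding W m).ncard ≤ Fintype.card A ^ m := by
  rw [← ncard_length_eq]
  exact Set.ncard_le_ncard (fun _ h => h.1) (List.finite_length_eq A m)

theorem ncard_dropLast_avoids [Fintype A] (m : ℕ) :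
    {u : List A | u.length = m + 1 ∧ Avoids W u.dropLast}.ncard =
      Fintype.card A * (avoiding W m).ncard := by
  have h : {u : List A | u.length = m + 1 ∧ Avoids W u.dropLast} =
      (fun p : A × List A => p.2 ++ [p.1]) '' (Set.univ ×ˢ avoiding W m) := by
    ext u
    simp only [Set.mem_ofPred_eq, Set.mem_image, Set.mem_prod, Set.mem_univ, true_and, avoiding]
    constructor
    · rintro ⟨h1, h2⟩
      have hne : u ≠ [] := by rintro rfl; simp at h1
      exact ⟨(u.getLast hne, u.dropLast), ⟨by simp [h1], h2⟩, List.dropLast_append_getLast hne⟩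
    · rintro ⟨⟨c, v⟩, ⟨h1, h2⟩, rfl⟩
      simp_all
  rw [h, Set.ncard_image_of_injective, Set.ncard_prod, Set.ncard_univ, Nat.card_eq_fintype_card]
  rintro ⟨c, v⟩ ⟨d, u⟩ h
  have := List.append_inj' h rfl
  simp_all

variable {ι : Type*} {w : ι → List A} {n : ℕ}

/-- Appending a letter to an avoiding word either keeps it avoiding or creates a forbidden suffix.
That suffix is unique, because the forbidden words are distinct and of equal length. -/
theorem ncard_avoiding_succ [Fintype ι] [Fintype A] (hw : Function.Injective w) (hn : ∀ i, (w i).length = n)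
    (m : ℕ) :
    (avoiding (Set.range w) (m + 1)).ncard +
      ∑ i, (firstHit (Set.range w) (w i) (m + 1)).ncard =
      Fintype.card A * (avoiding (Set.range w) m).ncard := by
  classical
  rw [← ncard_dropLast_avoids]
  set W := Set.range w
  have hfin : {u : List A | u.length = m + 1 ∧ Avoids W u.dropLast}.Finite :=
    (List.finite_length_eq A (m + 1)).subset fun _ h => h.1
  set S := hfin.toFinset with hS
  have hmem : ∀ u, u ∈ S ↔ u.length = m + 1 ∧ Avoids W u.dropLast := by simp [hS]
  have h1 : avoiding W (m + 1) = (S.filter fun u => Avoids W u : Finset (List A)) := by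
    ext u
    simp only [Finset.coe_filter, hmem, avoiding, Set.mem_ofPred_eq]
    exact ⟨fun h => ⟨⟨h.1, h.2.of_infix (List.dropLast_prefix u).isInfix⟩, h.2⟩,
      fun h => ⟨h.1.1, h.2⟩⟩
  have h2 : ∀ i, firstHit W (w i) (m + 1) = (S.filter fun u => w i <:+ u : Finset (List A)) := by
    intro i
    ext u
    simp only [Finset.coe_filter, hmem, firstHit, Set.mem_ofPred_eq, and_assoc]
  rw [h1, Set.ncard_eq_toFinset_card _ hfin, Set.ncard_coe_finset]
  simp_rw [h2, Set.ncard_coe_finset, Finset.card_filter]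
  rw [Finset.sum_comm, ← Finset.sum_add_distrib, Finset.card_eq_sum_ones]
  refine Finset.sum_congr rfl fun u hu => ?_
  rw [hmem] at hu
  have hne : u ≠ [] := by rintro rfl; simp at hu
  by_cases ha : Avoids W u
  · rw [if_pos ha, Finset.sum_eq_zero fun i _ => if_neg fun h => ha (w i) ⟨i, rfl⟩ h.isInfix,
      add_zero]
  · rw [if_neg ha]
    obtain ⟨_, ⟨i, rfl⟩, hi⟩ := not_avoids_concat (c := u.getLast hne) hu.2
      (by rwa [List.dropLast_append_getLast])
    rw [List.dropLast_append_getLast] at hi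
    rw [zero_add, Finset.sum_eq_single i, if_pos hi]
    · intro j _ hj
      refine if_neg fun h => hj (hw ?_)
      exact (List.suffix_of_suffix_length_le h hi (by simp [hn])).eq_of_length (by simp [hn])
    · simp

/-- While `w i` is appended to `v` letter by letter, a forbidden word must appear, at the latest
when `w i` is complete. The first time fixes `p.2`, and equality of lengths fixes the word `p.1`. -/
theorem exists_unique_firstHit (hw : Function.Injective w) (hn : ∀ i, (w i).length = n)
    (hpos : 0 < n) (i : ι) {v : List A} (hv : Avoids (Set.range w) v) :
    ∃! p : ι × ℕ, p.2 < n ∧ Avoids (Set.range w) (v ++ (w i).take p.2) ∧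
      w p.1 <:+ v ++ (w i).take (p.2 + 1) := by
  classical
  have hex : ∃ l, ¬ Avoids (Set.range w) (v ++ (w i).take (l + 1)) := by
    refine ⟨n - 1, fun h => h (w i) ⟨i, rfl⟩ ?_⟩
    rw [Nat.sub_add_cancel hpos, List.take_of_length_le (hn i).le]
    exact (List.suffix_append v (w i)).isInfix
  set l := Nat.find hex
  have hl : ¬ Avoids (Set.range w) (v ++ (w i).take (l + 1)) := Nat.find_spec hex
  have hpre : Avoids (Set.range w) (v ++ (w i).take l) := by
    rcases Nat.eq_zero_or_pos l with h | h
    · simpa [h] using hv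
    · have := Nat.find_min hex (m := l - 1) (by omega)
      rw [Nat.sub_add_cancel h] at this
      exact not_not.1 this
  have hln : l < n := by
    by_contra h
    have e : (w i).take (l + 1) = (w i).take l := by
      rw [List.take_of_length_le (by rw [hn]; omega), List.take_of_length_le (by rw [hn]; omega)]
    exact hl (e ▸ hpre)
  have htake : ∀ q (hq : q < n), v ++ (w i).take (q + 1) =
      (v ++ (w i).take q) ++ [(w i)[q]'(by rw [hn]; exact hq)] := by
    intro q hq
    rw [List.append_assoc, List.take_append_getElem]
  obtain ⟨_, ⟨j, rfl⟩, hj⟩ := not_avoids_concat hpre (htake l hln ▸ hl)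
  rw [← htake l hln] at hj
  refine ⟨(j, l), ⟨hln, hpre, hj⟩, ?_⟩
  rintro ⟨j', l'⟩ ⟨h1, h2, h3⟩
  simp only at h1 h2 h3
  have key : ∀ {q r : ℕ} {s : ι}, q < r → w s <:+ v ++ (w i).take (q + 1) →
      ¬ Avoids (Set.range w) (v ++ (w i).take r) := by
    intro q r s hqr hs h
    refine h (w s) ⟨s, rfl⟩ (hs.isInfix.trans (List.IsPrefix.isInfix ?_))
    rw [List.prefix_append_right_inj]
    exact List.take_prefix_take_left (by omega)
  have hll : l' = l := by
    rcases lt_trichotomy l' l with h | h | h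
    · exact absurd hpre (key h h3)
    · exact h
    · exact absurd h2 (key h hj)
  subst hll
  have : w j' = w j :=
    (List.suffix_of_suffix_length_le h3 hj (by simp [hn])).eq_of_length (by simp [hn])
  rw [hw this]

-- Sort the avoiding words `v` by the pair `(j, l)` of the first hit. Appending the first `l + 1`
-- letters of `w i` is injective, and its image is all of `firstHit` for `w j` when these letters
-- form a suffix of `w j`; otherwise the class is empty.
open Classical in
theorem ncard_avoiding_eq [Fintype ι] [Finite A] (hw : Function.Injective w) (hn : ∀ i, (w i).length = n)
    (hpos : 0 < n) (i : ι) (m : ℕ) :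
    (avoiding (Set.range w) m).ncard =
      ∑ j, ∑ l ∈ Finset.range n,
        if (w i).take (l + 1) <:+ w j then (firstHit (Set.range w) (w j) (m + l + 1)).ncard
        else 0 := by
  set W := Set.range w
  have hfin := finite_avoiding (W := W) m
  set S := hfin.toFinset with hS
  have hmem : ∀ u, u ∈ S ↔ u.length = m ∧ Avoids W u := by simp [hS, avoiding]
  have h1 : ∀ j, ∀ l ∈ Finset.range n, (if (w i).take (l + 1) <:+ w j then
      (firstHit W (w j) (m + l + 1)).ncard else 0) =
      (S.filter fun v => Avoids W (v ++ (w i).take l) ∧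
        w j <:+ v ++ (w i).take (l + 1)).card := by
    intro j l hl
    rw [Finset.mem_range] at hl
    have hlen : ((w i).take (l + 1)).length = l + 1 := by rw [List.length_take, hn]; omega
    have hdrop : ∀ v : List A, (v ++ (w i).take (l + 1)).dropLast = v ++ (w i).take l := by
      intro v
      rw [← List.take_append_getElem (by rw [hn]; exact hl), ← List.append_assoc,
        List.dropLast_concat]
    split_ifs with hb
    · rw [← Set.ncard_coe_finset, ← Set.ncard_image_of_injective (↑(S.filter _))
        (List.append_left_injective ((w i).take (l + 1)))]
      congr 1
      ext u
      simp only [firstHit, Set.mem_ofPred_eq, Finset.coe_filter, hmem, Set.mem_image]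
      constructor
      · rintro ⟨hu1, hu2, hu3⟩
        obtain ⟨v, rfl⟩ := hb.trans hu3
        rw [hdrop] at hu2
        refine ⟨v, ⟨⟨?_, hu2.of_infix (List.prefix_append _ _).isInfix⟩, hu2, hu3⟩, rfl⟩
        rw [List.length_append, hlen] at hu1
        omega
      · rintro ⟨v, ⟨⟨hv1, hv2⟩, hv3, hv4⟩, rfl⟩
        refine ⟨?_, by rwa [hdrop], hv4⟩
        rw [List.length_append, hlen, hv1, add_assoc]
    · symm
      rw [Finset.card_eq_zero, Finset.filter_eq_empty_iff]
      rintro v - ⟨-, hv⟩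
      exact hb (List.suffix_of_suffix_length_le (List.suffix_append _ _) hv
        (by rw [hlen, hn]; omega))
  rw [Finset.sum_congr rfl fun j _ => Finset.sum_congr rfl (h1 j),
    Set.ncard_eq_toFinset_card _ hfin, Finset.card_eq_sum_ones, ← Finset.sum_product']
  simp_rw [Finset.card_filter]
  rw [Finset.sum_comm]
  refine Finset.sum_congr rfl fun v hv => ?_
  obtain ⟨p, ⟨hp1, hp2⟩, hp⟩ := exists_unique_firstHit hw hn hpos i ((hmem v).1 hv).2
  symm
  rw [Finset.sum_eq_single p, if_pos hp2]
  · intro q hq hqp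
    refine if_neg fun h => hqp (hp q ⟨?_, h⟩)
    simpa using hq
  · intro h
    simp [hp1] at h

/-- This keeps only the term `j = i`, `l = n - 1`, where `w i` overlaps itself completely. -/
theorem ncard_firstHit_le [Fintype ι] [Finite A] (hw : Function.Injective w) (hn : ∀ i, (w i).length = n)
    (hpos : 0 < n) (i : ι) (m : ℕ) :
    (firstHit (Set.range w) (w i) (m + n)).ncard ≤ (avoiding (Set.range w) m).ncard := by
  classical
  rw [ncard_avoiding_eq hw hn hpos i]
  refine le_trans ?_ (Finset.single_le_sum (fun _ _ => Nat.zero_le _) (Finset.mem_univ i))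
  refine le_trans ?_ (Finset.single_le_sum (fun _ _ => Nat.zero_le _)
    (Finset.mem_range.2 (Nat.sub_lt hpos one_pos)))
  rw [add_assoc, Nat.sub_add_cancel (Nat.one_le_of_lt hpos), if_pos]
  rw [List.take_of_length_le (hn i).le]

end Words

/-! ### From avoiding words to avoiding sequences -/

section Extension

variable {A : Type*} {W : Set (List A)}

/-- If every letter were blocked, the blocking words would end in pairwise different letters, so
there would be at least as many words as letters. -/
theorem exists_avoids_concat [Fintype A] (hW : W.Finite) (hcard : W.ncard < Fintype.card A)
    {u : List A} (hu : Avoids W u) : ∃ c, Avoids W (u ++ [c]) := by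
  by_contra! h
  choose g hg hg' using fun c => not_avoids_concat hu (h c)
  by_cases hne : [] ∈ W
  · exact hu [] hne (List.nil_infix)
  have hinj : Function.Injective g := by
    intro c d hcd
    have hc : (g c).getLast (fun e => hne (e ▸ hg c)) = c := by
      rw [(hg' c).getLast]; simp
    have hd : (g d).getLast (fun e => hne (e ▸ hg d)) = d := by
      rw [(hg' d).getLast]; simp
    rw [← hc, ← hd]
    simp only [hcd]
  have := Set.ncard_le_ncard (Set.range_subset_iff.2 hg) hW
  rw [← Set.image_univ, Set.ncard_image_of_injective _ hinj, Set.ncard_univ,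
    Nat.card_eq_fintype_card] at this
  omega

theorem exists_avoiding_sequence [Fintype A] (hW : W.Finite) (hcard : W.ncard < Fintype.card A)
    {u : List A} (hu : Avoids W u) :
    ∃ y : ℕ → A, (∀ m, Avoids W (List.ofFn (prefixWord m y))) ∧
      List.ofFn (prefixWord u.length y) = u := by
  choose c hc using fun v : {v : List A // Avoids W v} => exists_avoids_concat hW hcard v.2
  let f : {v : List A // Avoids W v} → {v : List A // Avoids W v} :=
    fun v => ⟨v.1 ++ [c v], hc v⟩
  let L : ℕ → {v : List A // Avoids W v} := fun t => f^[t] ⟨u, hu⟩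
  have hsucc : ∀ t, (L (t + 1)).1 = (L t).1 ++ [c (L t)] := by
    intro t
    simp only [L, Function.iterate_succ_apply', f]
  have hlen : ∀ t, (L t).1.length = u.length + t := by
    intro t
    induction t with
    | zero => rfl
    | succ t ih => rw [hsucc, List.length_append, ih]; rfl
  have hpre : ∀ {s t}, s ≤ t → (L s).1 <+: (L t).1 := by
    intro s t hst
    induction hst with
    | refl => exact List.prefix_refl _
    | step _ ih => exact ih.trans (hsucc _ ▸ List.prefix_append _ _)
  -- Stage `i + 1` is long enough to have an entry at `i`, even when `u` is empty.
  let y : ℕ → A := fun i => (L (i + 1)).1[i]'(by rw [hlen]; omega)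
  have hy : ∀ m, List.ofFn (prefixWord m y) = (L m).1.take m := by
    intro m
    refine List.ext_getElem (by simp [hlen]) fun i h1 h2 => ?_
    simp only [List.length_ofFn] at h1
    simp only [List.getElem_ofFn, prefixWord, y, List.getElem_take]
    exact (hpre (by omega : i + 1 ≤ m)).getElem _
  refine ⟨y, fun m => ?_, ?_⟩
  · rw [hy]
    exact (L m).2.of_infix (List.take_prefix _ _).isInfix
  · rw [hy]
    exact ((List.prefix_iff_eq_take.1 (hpre (Nat.zero_le u.length) : u <+: _))).symm

theorem shift_iterate_apply (x : ℕ → A) (i j : ℕ) : shift^[i] x j = x (i + j) := by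
  induction i generalizing x with
  | zero => simp
  | succ i ih =>
    rw [Function.iterate_succ_apply, ih, shift]
    congr 1
    omega

theorem take_drop_ofFn_prefixWord (x : ℕ → A) {i n m : ℕ} (h : i + n ≤ m) :
    ((List.ofFn (prefixWord m x)).drop i).take n = List.ofFn (prefixWord n (shift^[i] x)) := by
  refine List.ext_getElem (by simp; omega) fun j h1 h2 => ?_
  simp [prefixWord, shift_iterate_apply]

/-- The words of `K` as lists. -/
def wordList {n : ℕ} (K : Finset (Fin n → A)) : Set (List A) := List.ofFn '' (K : Set (Fin n → A))

variable {n : ℕ} {K : Finset (Fin n → A)}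

theorem ofFn_mem_wordList {u : Fin n → A} : List.ofFn u ∈ wordList K ↔ u ∈ K := by
  simp [wordList, List.ofFn_injective.mem_set_image]

theorem finite_wordList : (wordList K).Finite := K.finite_toSet.image _

theorem ncard_wordList : (wordList K).ncard = K.card := by
  rw [wordList, Set.ncard_image_of_injective _ List.ofFn_injective, Set.ncard_coe_finset]

theorem avoids_ofFn_prefixWord_iff (x : ℕ → A) (m : ℕ) :
    Avoids (wordList K) (List.ofFn (prefixWord m x)) ↔
      ∀ i, i + n ≤ m → shift^[i] x ∉ hole K := by
  constructor
  · intro h i hi hx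
    refine h _ (ofFn_mem_wordList.2 hx) ?_
    rw [← take_drop_ofFn_prefixWord x hi]
    exact (List.take_prefix _ _).isInfix.trans (List.drop_suffix _ _).isInfix
  · rintro h _ ⟨u, hu, rfl⟩ ⟨s, t, hst⟩
    have hlen := congrArg List.length hst
    simp only [List.length_append, List.length_ofFn] at hlen
    have hi : s.length + n ≤ m := by omega
    refine h s.length hi ?_
    rw [hole, Set.mem_ofPred_eq, ← ofFn_mem_wordList, ← take_drop_ofFn_prefixWord x hi, ← hst,
      List.append_assoc, List.drop_left, List.take_left' (by simp), ofFn_mem_wordList]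
    exact hu

/-- The windows of length `n` starting at `0, …, m - 1` are exactly those inside the first `m + n -
1` symbols. -/
theorem avoidUpTo_eq (hn : 0 < n) (m : ℕ) :
    avoidUpTo K m =
      {x | List.ofFn (prefixWord (m + n - 1) x) ∈ avoiding (wordList K) (m + n - 1)} := by
  ext x
  simp only [avoidUpTo, avoiding, Set.mem_ofPred_eq, List.length_ofFn, true_and,
    avoids_ofFn_prefixWord_iff]
  refine forall_congr' fun i => ?_
  rw [show i < m ↔ i + n ≤ m + n - 1 by omega]

theorem ncard_language_perturbation [Fintype A] (hcard : K.card < Fintype.card A) (m : ℕ) :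
    (language (perturbation K) m).ncard = (avoiding (wordList K) m).ncard := by
  rw [← Set.ncard_image_of_injective _ (List.ofFn_injective (n := m))]
  congr 1
  ext u
  constructor
  · rintro ⟨_, ⟨x, hx, i, rfl⟩, rfl⟩
    refine ⟨by simp, (avoids_ofFn_prefixWord_iff _ _).2 fun j _ => ?_⟩
    rw [← Function.iterate_add_apply]
    exact hx _
  · rintro ⟨rfl, h2⟩
    obtain ⟨y, hy, hu⟩ := exists_avoiding_sequence finite_wordList
      (ncard_wordList.trans_lt hcard) h2
    refine ⟨_, ⟨y, fun i => ?_, 0, rfl⟩, hu⟩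
    exact (avoids_ofFn_prefixWord_iff y (i + n)).1 (hy _) i le_rfl

theorem ncard_avoiding_pos [Fintype A] (hn : 0 < n) (hcard : K.card < Fintype.card A) (m : ℕ) :
    0 < (avoiding (wordList K) m).ncard := by
  obtain ⟨y, hy, -⟩ := exists_avoiding_sequence finite_wordList
    (ncard_wordList.trans_lt hcard) (u := []) (by
      rintro _ ⟨u, -, rfl⟩ h
      have := h.length_le
      simp at this
      omega)
  rw [Set.ncard_pos (finite_avoiding m)]
  exact ⟨_, by simp, hy m⟩

end Extension

/-! ### Measures of cylinder sets -/

section Uniform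

variable {N : ℕ}

theorem uniformMeasure_prefixWord_eq [NeZero N] {m : ℕ} (u : Fin m → Fin N) :
    (uniformMeasure N).real {x | prefixWord m x = u} = ((N : ℝ) ^ m)⁻¹ := by
  have h : {x : ℕ → Fin N | prefixWord m x = u} =
      Set.pi (Finset.range m) (fun i => if h : i < m then {u ⟨i, h⟩} else Set.univ) := by
    ext x
    simp only [Set.mem_ofPred_eq, Set.mem_pi, Finset.coe_range, Set.mem_Iio, funext_iff,
      Fin.forall_iff, prefixWord]
    refine forall₂_congr fun i hi => ?_
    simp [hi]
  rw [h, uniformMeasure, measureReal_def, Measure.infinitePi_pi]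
  · rw [Finset.prod_congr rfl (g := fun _ => ((N : ENNReal))⁻¹), Finset.prod_const,
      Finset.card_range]
    · simp
    · intro i hi
      rw [dif_pos (Finset.mem_range.1 hi), ProbabilityTheory.uniformOn_univ]
      simp
  · intro i _
    exact (Set.toFinite _).measurableSet

theorem measurableSet_prefixWord_eq {m : ℕ} (u : Fin m → Fin N) :
    MeasurableSet {x : ℕ → Fin N | prefixWord m x = u} := by
  have : Measurable (prefixWord m : (ℕ → Fin N) → Fin m → Fin N) := by
    unfold prefixWord
    fun_prop
  exact this (measurableSet_singleton u)

theorem uniformMeasure_prefixWord_mem [NeZero N] {m : ℕ} (S : Finset (Fin m → Fin N)) :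
    (uniformMeasure N).real {x | prefixWord m x ∈ S} = S.card / (N : ℝ) ^ m := by
  have h : {x : ℕ → Fin N | prefixWord m x ∈ S} = ⋃ u ∈ S, {x | prefixWord m x = u} := by
    ext x; simp
  have : IsProbabilityMeasure (uniformMeasure N) := by unfold uniformMeasure; infer_instance
  rw [h, measureReal_biUnion_finset]
  · simp_rw [uniformMeasure_prefixWord_eq]
    rw [Finset.sum_const, nsmul_eq_mul, div_eq_mul_inv]
  · intro u _ v _ huv
    refine Set.disjoint_left.2 fun x hx hx' => huv ?_
    exact hx.symm.trans hx'
  · exact fun u _ => measurableSet_prefixWord_eq u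

theorem uniformMeasure_avoidUpTo [NeZero N] {n : ℕ} (hn : 0 < n) (K : Finset (Fin n → Fin N))
    (m : ℕ) :
    (uniformMeasure N).real (avoidUpTo K m) =
      (avoiding (wordList K) (m + n - 1)).ncard / (N : ℝ) ^ (m + n - 1) := by
  classical
  set M := m + n - 1
  have h := uniformMeasure_prefixWord_mem
    (Finset.univ.filter fun u : Fin M → Fin N => List.ofFn u ∈ avoiding (wordList K) M)
  rw [avoidUpTo_eq hn]
  simp only [Finset.mem_filter, Finset.mem_univ, true_and] at h
  rw [h]
  congr 2
  rw [← Set.ncard_coe_finset, ← Set.ncard_image_of_injective _ (List.ofFn_injective (n := M))]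
  congr 1
  ext u
  simp only [Finset.coe_filter, Finset.mem_univ, true_and, Set.mem_image, Set.mem_ofPred_eq]
  constructor
  · rintro ⟨v, hv, rfl⟩
    exact hv
  · intro hu
    have h1 : u.length = M := hu.1
    clear_value M
    subst h1
    exact ⟨u.get, by simpa using hu, by simp⟩

end Uniform

/-! ### Generating functions of the counting relations -/

section GeneratingFunction

theorem hasSum_shift_mul_pow {f : ℕ → ℝ} {r F : ℝ} (hr : r ≠ 0)
    (hF : HasSum (fun m => f m * r ^ m) F) {p : ℕ} (hf : ∀ m < p, f m = 0) :
    HasSum (fun m => f (m + p) * r ^ m) (r⁻¹ ^ p * F) := by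
  have h := (hasSum_nat_add_iff' p).2 hF
  rw [Finset.sum_eq_zero fun m hm => by rw [hf m (Finset.mem_range.1 hm), zero_mul],
    sub_zero] at h
  refine (h.mul_left (r⁻¹ ^ p)).congr_fun fun m => ?_
  rw [pow_add, inv_pow]
  field_simp

variable {ι : Type*} [Fintype ι] {a : ℕ → ℝ} {f : ι → ℕ → ℝ} {N r : ℝ} {n : ℕ}

theorem summable_of_succ_relation (ha : ∀ m, 0 ≤ a m) (hf : ∀ i m, 0 ≤ f i m) (hr : 0 < r)
    (h1 : ∀ m, a (m + 1) + ∑ i, f i (m + 1) = N * a m)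
    (hs : Summable fun m => a m * r ^ m) (i : ι) : Summable fun m => f i m * r ^ m := by
  rw [← summable_nat_add_iff 1]
  refine Summable.of_nonneg_of_le (fun m => mul_nonneg (hf _ _) (by positivity)) (fun m => ?_)
    (hs.mul_left (N * r))
  have : f i (m + 1) ≤ N * a m := by
    have h2 := Finset.single_le_sum (f := fun i => f i (m + 1)) (fun i _ => hf i _)
      (Finset.mem_univ i)
    linarith [h1 m, ha (m + 1)]
  calc f i (m + 1) * r ^ (m + 1) ≤ N * a m * r ^ (m + 1) := by gcongr
    _ = N * r * (a m * r ^ m) := by ring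

theorem tsum_succ_relation (ha : ∀ m, 0 ≤ a m) (hf : ∀ i m, 0 ≤ f i m) (hr : 0 < r)
    (ha0 : a 0 = 1) (hf0 : ∀ i, f i 0 = 0)
    (h1 : ∀ m, a (m + 1) + ∑ i, f i (m + 1) = N * a m)
    (hs : Summable fun m => a m * r ^ m) :
    (∑' m, a m * r ^ m) - 1 + ∑ i, ∑' m, f i m * r ^ m = N * r * ∑' m, a m * r ^ m := by
  have hfs := summable_of_succ_relation ha hf hr h1 hs
  have e2 : HasSum (fun m => a (m + 1) * r ^ (m + 1)) ((∑' m, a m * r ^ m) - 1) := by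
    have := (hasSum_nat_add_iff' 1).2 hs.hasSum
    simpa [ha0] using this
  have e3 : ∀ i, HasSum (fun m => f i (m + 1) * r ^ (m + 1)) (∑' m, f i m * r ^ m) := by
    intro i
    have := (hasSum_nat_add_iff' 1).2 (hfs i).hasSum
    simpa [hf0] using this
  have e4 := e2.add (hasSum_sum fun i (_ : i ∈ Finset.univ) => e3 i)
  refine e4.unique ?_
  refine (hs.hasSum.mul_left (N * r)).congr_fun fun m => ?_
  rw [← Finset.sum_mul, ← add_mul, h1]
  ring

theorem tsum_eq_sum_correlation {b : ι → ℕ → ℝ} (hr : 0 < r)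
    (hf0 : ∀ i, ∀ m < n, f i m = 0)
    (h2 : ∀ m, a m = ∑ j, ∑ l ∈ Finset.range n, b j l * f j (m + l + 1))
    (hfs : ∀ i, Summable fun m => f i m * r ^ m) :
    ∑' m, a m * r ^ m =
      ∑ j, (∑ l ∈ Finset.range n, b j l * r⁻¹ ^ (l + 1)) * ∑' m, f j m * r ^ m := by
  have e : ∀ j, ∀ l ∈ Finset.range n, HasSum (fun m => b j l * (f j (m + l + 1) * r ^ m))
      (b j l * (r⁻¹ ^ (l + 1) * ∑' m, f j m * r ^ m)) := by
    intro j l hl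
    rw [Finset.mem_range] at hl
    exact (hasSum_shift_mul_pow hr.ne' (hfs j).hasSum
      fun m hm => hf0 j m (by omega)).mul_left _
  have e' := hasSum_sum fun j (_ : j ∈ Finset.univ) => hasSum_sum (e j)
  refine HasSum.tsum_eq ?_
  convert e' using 2 with m j hj
  · rw [h2, Finset.sum_mul]
    refine Finset.sum_congr rfl fun j _ => ?_
    rw [Finset.sum_mul]
    refine Finset.sum_congr rfl fun l _ => by ring
  · rw [Finset.sum_mul]
    refine Finset.sum_congr rfl fun l _ => by ring

end GeneratingFunction

/-! ### Exponential growth rates -/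

section Growth

/-- `lam` is the exponential growth rate of `a`, and `a` dominates the powers of `lam`. -/
structure HasGrowth (a : ℕ → ℝ) (lam : ℝ) : Prop where
  pos : 0 < lam
  pow_le : ∀ m, lam ^ m ≤ a m
  tendsto : Tendsto (fun m : ℕ => Real.log (a m) / m) atTop (𝓝 (Real.log lam))

/-- By Fekete's lemma the limit of `log (a m) / m` is also its infimum, so the lower bound `lam ^ m
≤ a m` holds for every `m` without a constant. -/
theorem exists_hasGrowth {a : ℕ → ℝ} (ha : ∀ m, 1 ≤ a m)
    (hmul : ∀ m l, a (m + l) ≤ a m * a l) : ∃ lam, HasGrowth a lam := by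
  have hpos : ∀ m, 0 < a m := fun m => one_pos.trans_le (ha m)
  have hsub : Subadditive fun m => Real.log (a m) := by
    intro m l
    rw [← Real.log_mul (hpos m).ne' (hpos l).ne']
    exact Real.log_le_log (hpos _) (hmul m l)
  have hbdd : BddBelow (Set.range fun m : ℕ => Real.log (a m) / m) := by
    refine ⟨0, ?_⟩
    rintro _ ⟨m, rfl⟩
    exact div_nonneg (Real.log_nonneg (ha m)) (Nat.cast_nonneg m)
  refine ⟨Real.exp hsub.lim, Real.exp_pos _, fun m => ?_, ?_⟩
  · rcases Nat.eq_zero_or_pos m with rfl | hm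
    · simpa using ha 0
    · have h := hsub.lim_le_div hbdd hm.ne'
      rw [le_div_iff₀ (by exact_mod_cast hm)] at h
      rw [← Real.exp_nat_mul, ← Real.le_log_iff_exp_le (hpos m), mul_comm]
      exact h
  · rw [Real.log_exp]
    exact hsub.tendsto_lim hbdd

theorem HasGrowth.le {a : ℕ → ℝ} {lam N : ℝ} (h : HasGrowth a lam) (hN : ∀ m, a m ≤ N ^ m) :
    lam ≤ N := by
  simpa using (h.pow_le 1).trans (hN 1)

theorem HasGrowth.summable {a : ℕ → ℝ} {lam z : ℝ} (h : HasGrowth a lam) (hz : lam < z) :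
    Summable fun m => a m * z⁻¹ ^ m := by
  have hpos : ∀ m, 0 < a m := fun m => (pow_pos h.pos m).trans_le (h.pow_le m)
  obtain ⟨q, hq1, hq2⟩ := exists_between hz
  have hq : 0 < q := h.pos.trans hq1
  have hz0 : 0 < z := hq.trans hq2
  have hev : ∀ᶠ m : ℕ in atTop, a m ≤ q ^ m := by
    filter_upwards [h.tendsto.eventually_lt_const (Real.log_lt_log h.pos hq1),
      eventually_gt_atTop 0] with m hm hm0
    rw [div_lt_iff₀ (by exact_mod_cast hm0), mul_comm, ← Real.log_pow] at hm
    exact ((Real.log_lt_log_iff (hpos m) (by positivity)).1 hm).le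
  have hg : Summable fun m : ℕ => (q / z) ^ m :=
    summable_geometric_of_lt_one (by positivity) ((div_lt_one hz0).2 hq2)
  refine hg.of_norm_bounded_eventually_nat ?_
  filter_upwards [hev] with m hm
  rw [Real.norm_of_nonneg (mul_nonneg (hpos m).le (by positivity)), div_pow, inv_pow,
    div_eq_mul_inv]
  gcongr

theorem HasGrowth.le_tsum {a : ℕ → ℝ} {lam z : ℝ} (h : HasGrowth a lam) (hz : lam < z) :
    z / (z - lam) ≤ ∑' m, a m * z⁻¹ ^ m := by
  have hz0 : 0 < z := h.pos.trans hz
  have hlt : lam / z < 1 := (div_lt_one hz0).2 hz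
  have h0 : 0 ≤ lam / z := div_nonneg h.pos.le hz0.le
  have e : z / (z - lam) = (1 - lam / z)⁻¹ := by
    have : z - lam ≠ 0 := by linarith
    field_simp
  rw [e, ← tsum_geometric_of_lt_one h0 hlt]
  refine Summable.tsum_le_tsum (fun m => ?_) (summable_geometric_of_lt_one h0 hlt) (h.summable hz)
  rw [div_pow, inv_pow, div_eq_mul_inv]
  have := h.pow_le m
  gcongr

end Growth

/-! ### The correlation matrix and the growth rate -/

section Words

variable {A ι : Type*} [Fintype A] [Fintype ι] {w : ι → List A} {n : ℕ} {lam z : ℝ}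

open Classical in
/-- The correlation matrix of a family of words. -/
noncomputable def overlapMatrix (w : ι → List A) (n : ℕ) (z : ℝ) : Matrix ι ι ℝ :=
  Matrix.of fun i j => ∑ l ∈ Finset.range n, if (w i).take (l + 1) <:+ w j then z ^ l else 0

theorem exists_generatingFunctions (hw : Function.Injective w) (hn : ∀ i, (w i).length = n)
    (hpos : 0 < n)
    (hlam : HasGrowth (fun m => ((avoiding (Set.range w) m).ncard : ℝ)) lam) (hz : lam < z) :
    ∃ (S : ℝ) (F : ι → ℝ), z / (z - lam) ≤ S ∧
      S - 1 + ∑ i, F i = Fintype.card A * z⁻¹ * S ∧ (∀ i, F i ≤ z⁻¹ ^ n * S) ∧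
      (overlapMatrix w n z).mulVec F = fun _ => z⁻¹ * S := by
  classical
  set a : ℕ → ℝ := fun m => ((avoiding (Set.range w) m).ncard : ℝ) with ha_def
  set f : ι → ℕ → ℝ := fun i m => ((firstHit (Set.range w) (w i) m).ncard : ℝ) with hf_def
  have hz0 : 0 < z := hlam.pos.trans hz
  have ha : ∀ m, 0 ≤ a m := fun m => Nat.cast_nonneg _
  have hf : ∀ i m, 0 ≤ f i m := fun i m => Nat.cast_nonneg _
  have h1 : ∀ m, a (m + 1) + ∑ i, f i (m + 1) = (Fintype.card A : ℝ) * a m := fun m => by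
    simp only [ha_def, hf_def]
    exact_mod_cast ncard_avoiding_succ hw hn m
  have hf0 : ∀ i, ∀ m < n, f i m = 0 := fun i m hm => by
    simp [hf_def, firstHit_eq_empty (W := Set.range w) (w := w i) (m := m) (by rwa [hn])]
  have ha0 : a 0 = 1 := by
    have : avoiding (Set.range w) 0 = {[]} := avoiding_zero (by
      rintro _ ⟨i, rfl⟩ h
      have := hn i
      simp [h] at this
      omega)
    simp [ha_def, this]
  have h2 : ∀ i m, a m = ∑ j, ∑ l ∈ Finset.range n,
      (if (w i).take (l + 1) <:+ w j then (1 : ℝ) else 0) * f j (m + l + 1) := by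
    intro i m
    simp only [ha_def, hf_def, ncard_avoiding_eq hw hn hpos i m]
    push_cast
    simp
  have hs := hlam.summable hz
  have hr : 0 < z⁻¹ := inv_pos.2 hz0
  have hfs := summable_of_succ_relation ha hf hr h1 hs
  refine ⟨∑' m, a m * z⁻¹ ^ m, fun i => ∑' m, f i m * z⁻¹ ^ m, hlam.le_tsum hz,
    tsum_succ_relation ha hf hr ha0 (fun i => hf0 i 0 hpos) h1 hs, fun i => ?_, ?_⟩
  · have e := hasSum_shift_mul_pow hr.ne' (hfs i).hasSum (hf0 i)
    have h3 : z⁻¹⁻¹ ^ n * ∑' m, f i m * z⁻¹ ^ m ≤ ∑' m, a m * z⁻¹ ^ m := by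
      refine hasSum_le (fun m => ?_) e hs.hasSum
      have : f i (m + n) ≤ a m := by
        simp only [ha_def, hf_def]
        exact_mod_cast ncard_firstHit_le hw hn hpos i m
      gcongr
    rwa [inv_pow z⁻¹, inv_mul_le_iff₀ (by positivity)] at h3
  · funext i
    rw [tsum_eq_sum_correlation hr hf0 (h2 i) hfs, Matrix.mulVec, dotProduct, Finset.mul_sum]
    refine Finset.sum_congr rfl fun j _ => ?_
    rw [← mul_assoc, overlapMatrix, Matrix.of_apply, Finset.mul_sum]
    congr 1
    refine Finset.sum_congr rfl fun l _ => ?_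
    split_ifs
    · rw [inv_inv, pow_succ]
      field_simp
    · simp

/-- A crude bound that needs no matrix inversion: `F i ≤ z⁻¹ ^ n * S` is inserted into the
one-letter relation and `S > 0` is cancelled. It serves to show that `lam` is close to `N`. -/
theorem sub_le_of_hasGrowth (hw : Function.Injective w) (hn : ∀ i, (w i).length = n)
    (hpos : 0 < n)
    (hlam : HasGrowth (fun m => ((avoiding (Set.range w) m).ncard : ℝ)) lam) (hz : lam < z) :
    (Fintype.card A : ℝ) - z ≤ Fintype.card ι * z⁻¹ ^ n * z := by
  obtain ⟨S, F, hA, G1, hF, -⟩ := exists_generatingFunctions hw hn hpos hlam hz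
  have hz0 : 0 < z := hlam.pos.trans hz
  have hS : 0 < S := (div_pos hz0 (by linarith)).trans_le hA
  have hsum := Finset.sum_le_sum fun i (_ : i ∈ Finset.univ) => hF i
  rw [Finset.sum_const, Finset.card_univ, nsmul_eq_mul] at hsum
  have h3 : ((Fintype.card A : ℝ) * z⁻¹ - 1) * S ≤ (Fintype.card ι * z⁻¹ ^ n) * S := by
    linarith
  have h4 := le_of_mul_le_mul_right h3 hS
  calc (Fintype.card A : ℝ) - z = ((Fintype.card A : ℝ) * z⁻¹ - 1) * z := by field_simp
    _ ≤ _ := by gcongr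

theorem sum_inv_overlapMatrix_bounds [DecidableEq ι] (hw : Function.Injective w)
    (hn : ∀ i, (w i).length = n) (hpos : 0 < n)
    (hlam : HasGrowth (fun m => ((avoiding (Set.range w) m).ncard : ℝ)) lam) (hz : lam < z)
    (hM : IsUnit (overlapMatrix w n z)) :
    0 ≤ (∑ i, ∑ j, (overlapMatrix w n z)⁻¹ i j) - (Fintype.card A - z) ∧
      (∑ i, ∑ j, (overlapMatrix w n z)⁻¹ i j) - (Fintype.card A - z) ≤ z - lam := by
  obtain ⟨S, F, hA, G1, -, hMF⟩ := exists_generatingFunctions hw hn hpos hlam hz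
  have hz0 : 0 < z := hlam.pos.trans hz
  have hzl : 0 < z - lam := by linarith
  have hS : 0 < S := (div_pos hz0 hzl).trans_le hA
  have hFeq : F = (overlapMatrix w n z)⁻¹.mulVec fun _ => z⁻¹ * S := by
    rw [← hMF, Matrix.mulVec_mulVec, Matrix.nonsing_inv_mul _
      ((Matrix.isUnit_iff_isUnit_det _).1 hM), Matrix.one_mulVec]
  have hsumF : ∑ i, F i = (∑ i, ∑ j, (overlapMatrix w n z)⁻¹ i j) * (z⁻¹ * S) := by
    rw [hFeq, Finset.sum_mul]
    refine Finset.sum_congr rfl fun i _ => ?_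
    rw [Matrix.mulVec, dotProduct, Finset.sum_mul]
  rw [hsumF] at G1
  set R := ∑ i, ∑ j, (overlapMatrix w n z)⁻¹ i j
  -- After elimination of `F`, the one-letter relation reads `S - 1 + R S / z = N S / z`.
  have hR : R - (Fintype.card A - z) = z / S := by
    field_simp at G1 ⊢
    linarith
  rw [hR]
  refine ⟨by positivity, ?_⟩
  rw [div_le_iff₀ hS]
  rw [div_le_iff₀ hzl] at hA
  linarith

end Words

/-! ### Normalised correlation matrices and their limit -/

section Correlation

variable {A : Type*}

theorem take_ofFn_suffix_iff {n l : ℕ} (hl : l < n) (u w : Fin n → A) :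
    (List.ofFn w).take (l + 1) <:+ List.ofFn u ↔
      ∀ (i : Fin n) (j : Fin n), (i : ℕ) + l + 1 = n + j → u i = w j := by
  have hlen : ((List.ofFn w).take (l + 1)).length = l + 1 := by simp; omega
  rw [List.suffix_iff_eq_drop, hlen, List.length_ofFn]
  constructor
  · intro h i j hij
    have h1 : (j : ℕ) < ((List.ofFn w).take (l + 1)).length := by omega
    have h2 := (List.ext_getElem_iff.1 h).2 j h1 (by simp; omega)
    rw [List.getElem_take, List.getElem_drop, List.getElem_ofFn, List.getElem_ofFn] at h2
    rw [h2]
    congr 1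
    ext
    simp only
    omega
  · intro h
    refine List.ext_getElem (by simp; omega) fun j h1 h2 => ?_
    rw [List.getElem_take, List.getElem_drop, List.getElem_ofFn, List.getElem_ofFn]
    refine (h _ _ ?_).symm
    simp only
    omega

theorem overlapMatrix_eq_correlationMatrix {k : ℕ} (x : Fin k → ℕ → A) (n : ℕ) (z : ℝ) :
    overlapMatrix (fun i => List.ofFn (prefixWord n (x i))) n z = correlationMatrix x n z := by
  ext i j
  rw [overlapMatrix, correlationMatrix, Matrix.of_apply, Matrix.of_apply, correlation,
    Polynomial.eval_finsetSum]
  refine Finset.sum_congr rfl fun l hl => ?_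
  have h := take_ofFn_suffix_iff (Finset.mem_range.1 hl) (prefixWord n (x j)) (prefixWord n (x i))
  by_cases hs : (List.ofFn (prefixWord n (x i))).take (l + 1) <:+ List.ofFn (prefixWord n (x j))
  · rw [if_pos hs, if_pos (h.1 hs), Polynomial.eval_pow, Polynomial.eval_X]
  · rw [if_neg hs, if_neg (mt h.2 hs), Polynomial.eval_zero]

-- The substitution `s = n - 1 - l` indexes overlaps by the shift `s`, so that each normalised term
-- has a limit as `n` grows.
open Classical in
theorem correlationMatrix_apply {k : ℕ} (x : Fin k → ℕ → A) (n : ℕ) (z : ℝ) (i j : Fin k) :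
    correlationMatrix x n z i j =
      ∑ s ∈ Finset.range n, if ∀ p, s + p < n → x j (s + p) = x i p then z ^ (n - 1 - s) else 0 := by
  rw [correlationMatrix, Matrix.of_apply, correlation, Polynomial.eval_finsetSum,
    ← Finset.sum_range_reflect]
  refine Finset.sum_congr rfl fun s hs => ?_
  rw [Finset.mem_range] at hs
  have : (∀ (a b : Fin n), (a : ℕ) + (n - 1 - s) + 1 = n + b →
      prefixWord n (x j) a = prefixWord n (x i) b) ↔ ∀ p, s + p < n → x j (s + p) = x i p := by
    constructor
    · intro h p hp
      exact h ⟨s + p, hp⟩ ⟨p, by omega⟩ (by simp only; omega)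
    · intro h a b hab
      have := h b (by omega)
      rwa [show s + (b : ℕ) = a by omega] at this
  rw [if_congr this rfl rfl]
  split_ifs <;> simp

open Classical in
/-- The limit of the normalised correlation matrices at `z = N`. -/
noncomputable def limitCorrelation {k : ℕ} (x : Fin k → ℕ → A) (N : ℝ) :
    Matrix (Fin k) (Fin k) ℝ :=
  Matrix.of fun i j => ∑' s : ℕ, if ∀ p, x j (s + p) = x i p then N⁻¹ ^ (s + 1) else 0

theorem summable_inv_pow_succ {N : ℝ} (hN : 1 < N) : Summable fun s : ℕ => N⁻¹ ^ (s + 1) :=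
  (summable_nat_add_iff 1).2
    (summable_geometric_of_lt_one (by positivity) (inv_lt_one_of_one_lt₀ hN))

open Classical in
theorem summable_ite_inv_pow {N : ℝ} (hN : 1 < N) (P : ℕ → Prop) :
    Summable fun s : ℕ => if P s then N⁻¹ ^ (s + 1) else 0 := by
  refine (summable_inv_pow_succ hN).of_nonneg_of_le (fun s => ?_) fun s => ?_ <;>
  split_ifs <;> first | exact le_rfl | positivity

/-- Bernoulli's inequality gives the lower bound and `1 + t ≤ exp t` the upper one; exponents up to
`n` turn an error `1/n²` into `1/n`. -/
theorem pow_bounds_of_near_one {q : ℝ} {e n : ℕ} (hn1 : 1 ≤ n) (he : e ≤ n)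
    (hn : |q - 1| ≤ 1 / (n : ℝ) ^ 2) :
    0 ≤ q ∧ 1 - 1 / (n : ℝ) ≤ q ^ e ∧ q ^ e ≤ Real.exp (1 / (n : ℝ)) := by
  rw [abs_le] at hn
  have hn1' : (1 : ℝ) ≤ n := by exact_mod_cast hn1
  have hen : (e : ℝ) ≤ n := by exact_mod_cast he
  have hb : 1 / (n : ℝ) ^ 2 ≤ 1 := by
    rw [div_le_one (by positivity)]
    exact one_le_pow₀ hn1'
  have hene : (e : ℝ) * (1 / (n : ℝ) ^ 2) ≤ 1 / n := by
    calc (e : ℝ) * (1 / (n : ℝ) ^ 2) ≤ n * (1 / (n : ℝ) ^ 2) := by gcongr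
      _ = 1 / (n : ℝ) := by field_simp
  have hq : 0 ≤ q := by linarith
  refine ⟨hq, le_trans ?_ (one_add_mul_sub_le_pow (by linarith : -1 ≤ q) e), ?_⟩
  · have : (e : ℝ) * -(1 / (n : ℝ) ^ 2) ≤ e * (q - 1) := by
      gcongr
      exact hn.1
    linarith
  · calc q ^ e ≤ Real.exp (1 / (n : ℝ) ^ 2) ^ e := by
          gcongr
          linarith [Real.add_one_le_exp (1 / (n : ℝ) ^ 2)]
      _ = Real.exp (e * (1 / (n : ℝ) ^ 2)) := by rw [← Real.exp_nat_mul]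
      _ ≤ _ := Real.exp_le_exp.2 hene

theorem tendsto_pow_one_of_near_one {q : ℕ → ℝ} {e : ℕ → ℕ} (he : ∀ n, e n ≤ n)
    (hq : ∀ᶠ n : ℕ in atTop, |q n - 1| ≤ 1 / (n : ℝ) ^ 2) :
    Tendsto (fun n => q n ^ e n) atTop (𝓝 1) := by
  have h0 := tendsto_one_div_atTop_nhds_zero_nat (𝕜 := ℝ)
  have h1 : Tendsto (fun n : ℕ => 1 - 1 / (n : ℝ)) atTop (𝓝 1) := by
    simpa using tendsto_const_nhds.sub h0
  have h2 : Tendsto (fun n : ℕ => Real.exp (1 / (n : ℝ))) atTop (𝓝 1) := by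
    have := (Real.continuous_exp.tendsto 0).comp h0
    rwa [Real.exp_zero] at this
  refine tendsto_of_tendsto_of_tendsto_of_le_of_le' h1 h2 ?_ ?_ <;>
    filter_upwards [hq, eventually_ge_atTop 1] with n hn hn1
  · exact (pow_bounds_of_near_one hn1 (he n) hn).2.1
  · exact (pow_bounds_of_near_one hn1 (he n) hn).2.2

theorem tendsto_correlationMatrix {k : ℕ} (x : Fin k → ℕ → A) {N : ℝ} (hN : 1 < N)
    {z : ℕ → ℝ} (hz : ∀ᶠ n : ℕ in atTop, |z n / N - 1| ≤ 1 / (n : ℝ) ^ 2) :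
    Tendsto (fun n : ℕ => (N ^ n)⁻¹ • correlationMatrix x n (z n)) atTop
      (𝓝 (limitCorrelation x N)) := by
  classical
  have hN0 : 0 < N := one_pos.trans hN
  refine tendsto_pi_nhds.2 fun i => tendsto_pi_nhds.2 fun j => ?_
  set g : ℕ → ℕ → ℝ := fun n s =>
    if s < n ∧ ∀ p, s + p < n → x j (s + p) = x i p then
      N⁻¹ ^ (s + 1) * (z n / N) ^ (n - 1 - s) else 0 with hg
  have hgeq : ∀ n, ((N ^ n)⁻¹ • correlationMatrix x n (z n)) i j = ∑' s, g n s := by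
    intro n
    rw [tsum_eq_sum (s := Finset.range n)
      (fun s hs => if_neg fun h => hs (Finset.mem_range.2 h.1)),
      Matrix.smul_apply, correlationMatrix_apply, smul_eq_mul, Finset.mul_sum]
    refine Finset.sum_congr rfl fun s hs => ?_
    rw [Finset.mem_range] at hs
    simp only [hs, true_and]
    split_ifs
    · obtain ⟨d, rfl⟩ := Nat.exists_eq_add_of_lt hs
      rw [show s + d + 1 - 1 - s = d by omega, div_pow, inv_pow,
        show s + d + 1 = (s + 1) + d by omega, pow_add]
      field_simp
    · simp
  simp_rw [hgeq]
  -- The factor `3` dominates `(z n / N) ^ (n - 1 - s) ≤ exp (1/n) ≤ e`.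
  refine tendsto_tsum_of_dominated_convergence
    (bound := fun s => N⁻¹ ^ (s + 1) * 3) ((summable_inv_pow_succ hN).mul_right 3) ?_ ?_
  · intro s
    have hpow := tendsto_pow_one_of_near_one (e := fun n => n - 1 - s) (fun n => by omega) hz
    by_cases h : ∀ p, x j (s + p) = x i p
    · rw [if_pos h]
      have := hpow.const_mul (N⁻¹ ^ (s + 1))
      rw [mul_one] at this
      refine this.congr' ?_
      filter_upwards [eventually_gt_atTop s] with n hn
      simp only [hg]
      rw [if_pos ⟨hn, fun p _ => h p⟩]
    · rw [if_neg h]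
      push Not at h
      obtain ⟨p, hp⟩ := h
      refine tendsto_const_nhds.congr' ?_
      filter_upwards [eventually_gt_atTop (s + p)] with n hn
      simp only [hg]
      rw [if_neg fun h => hp (h.2 p hn)]
  · filter_upwards [hz, eventually_ge_atTop 1] with n hn hn1 s
    obtain ⟨h0, -, h1⟩ := pow_bounds_of_near_one (e := n - 1 - s) hn1 (by omega) hn
    have h2 : Real.exp (1 / (n : ℝ)) ≤ Real.exp 1 := by
      rw [Real.exp_le_exp, div_le_one (by positivity)]
      exact_mod_cast hn1
    have h3 := Real.exp_one_lt_three
    simp only [hg]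
    split_ifs
    · rw [Real.norm_of_nonneg (by positivity)]
      gcongr
      linarith
    · rw [norm_zero]
      positivity

/-- The columns are strictly diagonally dominant. Shift `0` contributes at least `1/N` to the
diagonal and nothing off it, since the points are distinct. Each shift `s ≥ 1` carries `x j` to at
most one `x i`, so the rest of the column sums to at most `1/(N(N-1))`, which is less than `1/N`
once `k ≥ 2` forces `N ≥ 3`. -/
theorem isUnit_limitCorrelation {N k : ℕ} (hk : 1 ≤ k) (hkN : k < N) {x : Fin k → ℕ → A}
    (hx : Function.Injective x) : IsUnit (limitCorrelation x N) := by
  classical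
  rw [Matrix.isUnit_iff_isUnit_det, isUnit_iff_ne_zero]
  have hN1 : 1 < (N : ℝ) := by exact_mod_cast (by omega : 1 < N)
  have hN0 : 0 < (N : ℝ) := by linarith
  have hnn : ∀ i j, 0 ≤ limitCorrelation x N i j := fun i j => by
    refine tsum_nonneg fun s => ?_
    split_ifs <;> first | exact le_rfl | positivity
  refine det_ne_zero_of_sum_col_lt_diag fun j => ?_
  simp_rw [Real.norm_of_nonneg (hnn _ _)]
  have hdiag : (N : ℝ)⁻¹ ≤ limitCorrelation x N j j := by
    refine le_trans ?_ ((summable_ite_inv_pow hN1 fun s => ∀ p, x j (s + p) = x j p).le_tsum 0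
      fun s _ => ?_)
    · simp
    · split_ifs <;> first | exact le_rfl | positivity
  refine lt_of_lt_of_le ?_ hdiag
  rcases Nat.lt_or_ge k 2 with hk2 | hk2
  · have : Finset.univ.erase j = ∅ := by
      ext i
      simp only [Finset.mem_erase, Finset.mem_univ, and_true, Finset.notMem_empty, iff_false,
        not_not]
      ext
      omega
    rw [this, Finset.sum_empty]
    positivity
  · have hN3 : (3 : ℝ) ≤ N := by exact_mod_cast (by omega : 3 ≤ N)
    have hgeom : HasSum (fun s : ℕ => (N : ℝ)⁻¹ ^ (s + 1 + 1)) ((N : ℝ)⁻¹ * (N - 1 : ℝ)⁻¹) := by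
      have h := (hasSum_geometric_of_lt_one (inv_nonneg.2 hN0.le)
        (inv_lt_one_of_one_lt₀ hN1)).mul_left ((N : ℝ)⁻¹ ^ 2)
      have e : (N : ℝ)⁻¹ ^ 2 * (1 - (N : ℝ)⁻¹)⁻¹ = (N : ℝ)⁻¹ * (N - 1 : ℝ)⁻¹ := by
        have h1 : (N : ℝ) - 1 ≠ 0 := by linarith
        rw [show 1 - (N : ℝ)⁻¹ = (N - 1) * (N : ℝ)⁻¹ by field_simp, mul_inv, inv_inv]
        field_simp
      rw [e] at h
      exact h.congr_fun fun s => by ring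
    have hcol : ∑ i ∈ Finset.univ.erase j, limitCorrelation x N i j ≤
        (N : ℝ)⁻¹ * (N - 1 : ℝ)⁻¹ := by
      simp only [limitCorrelation, Matrix.of_apply]
      have hsum := summable_sum fun i (_ : i ∈ Finset.univ.erase j) =>
        summable_ite_inv_pow hN1 fun s => ∀ p, x j (s + p) = x i p
      rw [← Summable.tsum_finsetSum fun i _ => summable_ite_inv_pow hN1 _,
        Summable.tsum_eq_zero_add hsum]
      have h0 : ∑ i ∈ Finset.univ.erase j,
          (if ∀ p, x j (0 + p) = x i p then (N : ℝ)⁻¹ ^ (0 + 1) else 0) = 0 := by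
        refine Finset.sum_eq_zero fun i hi => if_neg fun h => Finset.ne_of_mem_erase hi ?_
        refine hx (funext fun p => ?_)
        rw [← h p, zero_add]
      rw [h0, zero_add, ← hgeom.tsum_eq]
      refine Summable.tsum_le_tsum (fun s => ?_) ?_ hgeom.summable
      · rw [← Finset.sum_filter, Finset.sum_const, nsmul_eq_mul]
        have hc : ((Finset.univ.erase j).filter fun i => ∀ p, x j (s + 1 + p) = x i p).card ≤ 1 := by
          refine Finset.card_le_one.2 fun a ha b hb => hx (funext fun p => ?_)
          rw [← (Finset.mem_filter.1 ha).2 p, ← (Finset.mem_filter.1 hb).2 p]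
        exact mul_le_of_le_one_left (by positivity) (by exact_mod_cast hc)
      · exact hsum.comp_injective (add_left_injective 1)
    refine hcol.trans_lt ?_
    have : (N - 1 : ℝ)⁻¹ < 1 := inv_lt_one_of_one_lt₀ (by linarith)
    have h' : 0 < (N : ℝ)⁻¹ := by positivity
    nlinarith

end Correlation

/-! ### Asymptotics of entropy and escape rate -/

section Asymptotics

theorem tendsto_matrix_inv {ι : Type*} [Fintype ι] [DecidableEq ι] {B : ℕ → Matrix ι ι ℝ}
    {α : Matrix ι ι ℝ} (hB : Tendsto B atTop (𝓝 α)) (hα : IsUnit α) :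
    Tendsto (fun n => (B n)⁻¹) atTop (𝓝 α⁻¹) := by
  obtain ⟨d, hd⟩ := (Matrix.isUnit_iff_isUnit_det _).1 hα
  exact (continuousAt_matrix_inv α (hd ▸ NormedRing.inverse_continuousAt d)).tendsto.comp hB

theorem exists_hasGrowth_avoiding {A : Type*} [Fintype A] {n : ℕ} (hn : 0 < n)
    {K : Finset (Fin n → A)} (hcard : K.card < Fintype.card A) :
    ∃ lam, HasGrowth (fun m => ((avoiding (wordList K) m).ncard : ℝ)) lam :=
  exists_hasGrowth (fun m => by exact_mod_cast ncard_avoiding_pos hn hcard m)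
    fun m l => by exact_mod_cast ncard_avoiding_add_le m l

theorem hasEntropy_perturbation {A : Type*} [Fintype A] {n : ℕ} {K : Finset (Fin n → A)}
    (hcard : K.card < Fintype.card A) {lam : ℝ}
    (h : HasGrowth (fun m => ((avoiding (wordList K) m).ncard : ℝ)) lam) :
    HasEntropy (perturbation K) (Real.log lam) := by
  refine h.tendsto.congr fun m => ?_
  rw [ncard_language_perturbation hcard, one_div, inv_mul_eq_div]

theorem hasEntropy_univ (N : ℕ) [NeZero N] :
    HasEntropy (Set.univ : Set (ℕ → Fin N)) (Real.log N) := by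
  refine tendsto_const_nhds.congr' ?_
  filter_upwards [eventually_gt_atTop 0] with m hm
  have h : language (Set.univ : Set (ℕ → Fin N)) m = Set.univ := by
    refine Set.eq_univ_of_forall fun u =>
      ⟨fun i => if h : i < m then u ⟨i, h⟩ else 0, trivial, 0, ?_⟩
    funext i
    simp [prefixWord]
  rw [h, Set.ncard_univ, Nat.card_eq_fintype_card, Fintype.card_fun, Fintype.card_fin,
    Fintype.card_fin]
  push_cast
  rw [Real.log_pow]
  field_simp

theorem hasEscapeRate_of_hasGrowth {N n : ℕ} [NeZero N] (hn : 0 < n) {K : Finset (Fin n → Fin N)}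
    {lam : ℝ} (h : HasGrowth (fun m => ((avoiding (wordList K) m).ncard : ℝ)) lam) :
    HasEscapeRate K (Real.log N - Real.log lam) := by
  have hN : (N : ℝ) ≠ 0 := Nat.cast_ne_zero.2 (NeZero.ne N)
  have h1 : Tendsto (fun m : ℕ => m + (n - 1)) atTop atTop := tendsto_add_atTop_nat _
  have h2 := h.tendsto.comp h1
  have h3 : Tendsto (fun m : ℕ => 1 + ((n - 1 : ℕ) : ℝ) / m) atTop (𝓝 1) := by
    simpa using (tendsto_const_div_atTop_nhds_zero_nat ((n - 1 : ℕ) : ℝ)).const_add 1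
  have h4 := ((tendsto_const_nhds (x := Real.log N)).sub h2).mul h3
  rw [mul_one] at h4
  refine h4.congr' ?_
  filter_upwards [eventually_gt_atTop 0] with m hm
  rw [uniformMeasure_avoidUpTo hn, Nat.add_sub_assoc hn, Real.log_div
    ((pow_pos h.pos _).trans_le (h.pow_le _)).ne' (pow_ne_zero _ hN), Real.log_pow]
  simp only [Function.comp_apply]
  have hm' : (m : ℝ) ≠ 0 := by positivity
  have hM : ((m + (n - 1) : ℕ) : ℝ) = m + (n - 1 : ℕ) := by push_cast; rfl
  have hM' : (m : ℝ) + (n - 1 : ℕ) ≠ 0 := by positivity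
  rw [hM]
  field_simp
  ring

theorem eventually_injective_prefixWord {A : Type*} {ι : Type*} [Finite ι] {x : ι → ℕ → A}
    (hx : Function.Injective x) :
    ∀ᶠ n in atTop, Function.Injective fun i => prefixWord n (x i) := by
  have h : ∀ i j, ∀ᶠ n in atTop, prefixWord n (x i) = prefixWord n (x j) → i = j := by
    intro i j
    by_cases hij : i = j
    · exact Eventually.of_forall fun _ _ => hij
    · obtain ⟨p, hp⟩ := Function.ne_iff.1 (hx.ne hij)
      filter_upwards [eventually_gt_atTop p] with n hn h
      exact absurd (congrFun h ⟨p, hn⟩) hp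
  filter_upwards [eventually_all.2 fun i => eventually_all.2 (h i)] with n hn i j hij
  exact hn i j hij

/-- Otherwise `sub_le_of_hasGrowth` applies at `z = N - 1/n² ≥ 3/2` and gives `1/n² ≤ k (2/3)^n N`,
which fails for large `n`. -/
theorem eventually_le_of_hasGrowth {N k : ℕ} (hN : 2 ≤ N) {x : Fin k → ℕ → Fin N}
    (hx : Function.Injective x) {lam : ℕ → ℝ}
    (hlam : ∀ᶠ n in atTop, HasGrowth (fun m => ((avoiding
      (Set.range fun i => List.ofFn (prefixWord n (x i))) m).ncard : ℝ)) (lam n)) :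
    ∀ᶠ n : ℕ in atTop, (N : ℝ) - 1 / (n : ℝ) ^ 2 ≤ lam n := by
  have hN' : (2 : ℝ) ≤ N := by exact_mod_cast hN
  have hlim := (tendsto_pow_const_mul_const_pow_of_lt_one 2 (by norm_num : (0 : ℝ) ≤ 2 / 3)
    (by norm_num)).mul_const ((k : ℝ) * N)
  rw [zero_mul] at hlim
  filter_upwards [hlam, eventually_injective_prefixWord hx, hlim.eventually_lt_const one_pos,
    eventually_ge_atTop 2] with n hg hinj hsmall hn
  by_contra! hlt
  have h := sub_le_of_hasGrowth (fun i j hij => hinj (List.ofFn_injective hij))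
    (fun i => List.length_ofFn) (by omega) hg hlt
  rw [Fintype.card_fin, Fintype.card_fin, sub_sub_cancel] at h
  have hn' : (2 : ℝ) ≤ n := by exact_mod_cast hn
  have hn2 : 1 / (n : ℝ) ^ 2 ≤ 1 / 2 := by
    refine one_div_le_one_div_of_le two_pos ?_
    nlinarith
  set c := (N : ℝ) - 1 / (n : ℝ) ^ 2
  have hc1 : 3 / 2 ≤ c := by linarith
  have hc2 : c ≤ N := sub_le_self _ (by positivity)
  have hcinv : c⁻¹ ≤ 2 / 3 := by
    rw [inv_le_comm₀ (by linarith) (by norm_num)]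
    linarith
  have h5 : 1 / (n : ℝ) ^ 2 ≤ k * (2 / 3) ^ n * N := h.trans (by gcongr)
  rw [div_le_iff₀ (by positivity)] at h5
  linarith

theorem tendsto_pow_mul_sub {N k : ℕ} (hk : 1 ≤ k) (hkN : k < N) {x : Fin k → ℕ → Fin N}
    (hx : Function.Injective x) {lam : ℕ → ℝ}
    (hlam : ∀ᶠ n in atTop, HasGrowth (fun m => ((avoiding
      (Set.range fun i => List.ofFn (prefixWord n (x i))) m).ncard : ℝ)) (lam n)) :
    Tendsto (fun n => (N : ℝ) ^ n * (N - lam n)) atTop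
      (𝓝 (∑ i, ∑ j, (limitCorrelation x (N : ℝ))⁻¹ i j)) := by
  have hN1 : (1 : ℝ) < N := by exact_mod_cast (by omega : 1 < N)
  have hN0 : (0 : ℝ) < N := by linarith
  -- The offset `N^(-2n)` keeps `z n` above `lam n` and still vanishes after multiplication by
  -- `N^n`.
  set ε : ℕ → ℝ := fun n => ((N : ℝ) ^ n)⁻¹ ^ 2 with hε
  have hεpos : ∀ n, 0 < ε n := fun n => by positivity
  set z : ℕ → ℝ := fun n => lam n + ε n with hzdef
  have hz : ∀ᶠ n : ℕ in atTop, |z n / N - 1| ≤ 1 / (n : ℝ) ^ 2 := by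
    filter_upwards [eventually_le_of_hasGrowth (by omega) hx hlam, hlam,
      eventually_gt_atTop 0] with n h1 h2 hn
    have hn' : (0 : ℝ) < n := by exact_mod_cast hn
    have h3 : lam n ≤ N := h2.le fun m => by
      have := ncard_avoiding_le (W := Set.range fun i => List.ofFn (prefixWord n (x i))) m
      rw [Fintype.card_fin] at this
      exact_mod_cast this
    have h4 : ε n ≤ 1 / (n : ℝ) ^ 2 := by
      have : (n : ℝ) ≤ (N : ℝ) ^ n := by
        exact_mod_cast (Nat.lt_pow_self (by omega : 1 < N)).le
      simp only [hε]
      rw [one_div, ← inv_pow (n : ℝ)]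
      gcongr
    have h5 : |z n - N| ≤ 1 / (n : ℝ) ^ 2 := by
      rw [abs_le]
      constructor <;> linarith [hεpos n]
    rw [div_sub_one hN0.ne', abs_div, abs_of_pos hN0, div_le_iff₀ hN0]
    exact h5.trans (le_mul_of_one_le_right (by positivity) hN1.le)
  have hα := isUnit_limitCorrelation hk hkN hx
  have hB := tendsto_correlationMatrix x hN1 hz
  have hBinv := tendsto_matrix_inv hB hα
  have hT : Tendsto (fun n => ∑ i, ∑ j, (((N : ℝ) ^ n)⁻¹ • correlationMatrix x n (z n))⁻¹ i j)
      atTop (𝓝 (∑ i, ∑ j, (limitCorrelation x (N : ℝ))⁻¹ i j)) :=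
    tendsto_finsetSum _ fun i _ => tendsto_finsetSum _ fun j _ =>
      tendsto_pi_nhds.1 (tendsto_pi_nhds.1 hBinv i) j
  have hdet : ∀ᶠ n in atTop, (((N : ℝ) ^ n)⁻¹ • correlationMatrix x n (z n)).det ≠ 0 :=
    ((continuous_id.matrix_det.tendsto _).comp hB).eventually_ne
      ((Matrix.isUnit_iff_isUnit_det _).1 hα).ne_zero
  have hsmall : Tendsto (fun n : ℕ => ((N : ℝ) ^ n)⁻¹) atTop (𝓝 0) := by
    simpa [inv_pow] using
      tendsto_pow_atTop_nhds_zero_of_lt_one (inv_nonneg.2 hN0.le) (inv_lt_one_of_one_lt₀ hN1)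
  have hupper := hT.add hsmall
  rw [add_zero] at hupper
  have hmain : ∀ᶠ n in atTop,
      (∑ i, ∑ j, (((N : ℝ) ^ n)⁻¹ • correlationMatrix x n (z n))⁻¹ i j) ≤ (N : ℝ) ^ n * (N - lam n) ∧
      (N : ℝ) ^ n * (N - lam n) ≤
        (∑ i, ∑ j, (((N : ℝ) ^ n)⁻¹ • correlationMatrix x n (z n))⁻¹ i j) + ((N : ℝ) ^ n)⁻¹ := by
    filter_upwards [hdet, hlam, eventually_injective_prefixWord hx, eventually_gt_atTop 0]
      with n hd hg hinj hn
    have hp : (0 : ℝ) < (N : ℝ) ^ n := by positivity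
    rw [Matrix.det_smul] at hd
    have hd' : IsUnit (correlationMatrix x n (z n)).det := (right_ne_zero_of_mul hd).isUnit
    have hinv : (((N : ℝ) ^ n)⁻¹ • correlationMatrix x n (z n))⁻¹ =
        (N : ℝ) ^ n • (correlationMatrix x n (z n))⁻¹ := by
      have := Matrix.inv_smul' (A := correlationMatrix x n (z n))
        (Units.mk0 ((N : ℝ) ^ n)⁻¹ (by positivity)) hd'
      simpa [Units.smul_def] using this
    have h := sum_inv_overlapMatrix_bounds (z := z n)
      (fun i j hij => hinj (List.ofFn_injective hij)) (fun i => List.length_ofFn) hn hg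
      (by linarith [hεpos n])
      (by rwa [overlapMatrix_eq_correlationMatrix, Matrix.isUnit_iff_isUnit_det])
    rw [overlapMatrix_eq_correlationMatrix, Fintype.card_fin] at h
    have hsum : (∑ i, ∑ j, (((N : ℝ) ^ n)⁻¹ • correlationMatrix x n (z n))⁻¹ i j) =
        (N : ℝ) ^ n * ∑ i, ∑ j, (correlationMatrix x n (z n))⁻¹ i j := by
      simp only [hinv, Matrix.smul_apply, smul_eq_mul, Finset.mul_sum]
    rw [hsum]
    have hpe : (N : ℝ) ^ n * ε n = ((N : ℝ) ^ n)⁻¹ := by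
      simp only [hε]
      field_simp
    rw [← hpe, ← mul_add]
    constructor <;> gcongr <;> linarith
  exact tendsto_of_tendsto_of_tendsto_of_le_of_le' hT hupper
    (hmain.mono fun n h => h.1) (hmain.mono fun n h => h.2)

/-- The estimate `1 - lam/N ≤ log (N/lam) ≤ N/lam - 1` squeezes the expression, and the hypothesis
forces `lam → N`. -/
theorem tendsto_pow_mul_log_sub {N T : ℝ} (hN : 1 < N) {lam : ℕ → ℝ}
    (hlam : ∀ᶠ n in atTop, 0 < lam n)
    (h : Tendsto (fun n => N ^ n * (N - lam n)) atTop (𝓝 T)) :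
    Tendsto (fun n => N ^ n * (Real.log N - Real.log (lam n))) atTop (𝓝 (T / N)) := by
  have hN0 : 0 < N := by linarith
  have hsmall : Tendsto (fun n : ℕ => N⁻¹ ^ n) atTop (𝓝 0) :=
    tendsto_pow_atTop_nhds_zero_of_lt_one (inv_nonneg.2 hN0.le) (inv_lt_one_of_one_lt₀ hN)
  have hl : Tendsto lam atTop (𝓝 N) := by
    have := (tendsto_const_nhds (x := N)).sub (hsmall.mul h)
    rw [zero_mul, sub_zero] at this
    refine this.congr fun n => ?_
    rw [← mul_assoc, ← mul_pow, inv_mul_cancel₀ hN0.ne', one_pow]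
    ring
  refine tendsto_of_tendsto_of_tendsto_of_le_of_le' (h.div_const N) (h.div hl hN0.ne') ?_ ?_ <;>
    filter_upwards [hlam] with n hn
  · have := Real.one_sub_inv_le_log_of_pos (div_pos hN0 hn)
    rw [Real.log_div hN0.ne' hn.ne', inv_div] at this
    rw [mul_div_assoc]
    gcongr
    rwa [sub_div, div_self hN0.ne']
  · have := Real.log_le_sub_one_of_pos (div_pos hN0 hn)
    rw [Real.log_div hN0.ne' hn.ne'] at this
    simp only [Pi.div_apply]
    rw [mul_div_assoc]
    gcongr
    rwa [sub_div, div_self hn.ne']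

end Asymptotics

theorem mainTheorem11 (N k : ℕ) (hk : 1 ≤ k) (hkN : k < N)
    (K : (n : ℕ) → Finset (Fin n → Fin N))
    (hcard : ∀ n, 1 ≤ n → (K n).card = k)
    (hnest : ∀ n, 1 ≤ n → hole (K (n + 1)) ⊆ hole (K n))
    (x : Fin k → ℕ → Fin N) (hx : Function.Injective x)
    (hlim : (⋂ n ∈ Set.Ici 1, hole (K n)) = Set.range x) :
    ∃ α : Matrix (Fin k) (Fin k) ℝ,
      IsLimitCorrelation x (N : ℝ) α ∧ IsUnit α ∧
      HasLocalEscapeRate K ((∑ i, ∑ j, α⁻¹ i j) / ((k : ℝ) * (N : ℝ))) ∧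
      ∃ (h₀ : ℝ) (h : ℕ → ℝ), HasEntropy (Set.univ : Set (ℕ → Fin N)) h₀ ∧
        (∀ n, 1 ≤ n → HasEntropy (perturbation (K n)) (h n)) ∧
        Tendsto (fun n : ℕ => (h₀ - h n) / ((k : ℝ) / (N : ℝ) ^ n)) atTop
          (𝓝 ((∑ i, ∑ j, α⁻¹ i j) / ((k : ℝ) * (N : ℝ)))) := by
  have : NeZero N := ⟨by omega⟩
  have hN1 : (1 : ℝ) < N := by exact_mod_cast (by omega : 1 < N)
  have hk0 : (k : ℝ) ≠ 0 := by positivity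
  have hcard' : ∀ n, 1 ≤ n → (K n).card < Fintype.card (Fin N) := fun n hn => by
    rwa [hcard n hn, Fintype.card_fin]
  have hex : ∀ n, ∃ lam, 1 ≤ n →
      HasGrowth (fun m => ((avoiding (wordList (K n)) m).ncard : ℝ)) lam := by
    intro n
    by_cases hn : 1 ≤ n
    · obtain ⟨lam, h⟩ := exists_hasGrowth_avoiding hn (hcard' n hn)
      exact ⟨lam, fun _ => h⟩
    -- The value at `n = 0` is arbitrary; only `n ≥ 1` matters.
    · exact ⟨0, fun h => absurd h hn⟩
  choose lam hlam using hex
  have hmem : ∀ n, 1 ≤ n → ∀ i, prefixWord n (x i) ∈ K n := by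
    intro n hn i
    have : x i ∈ ⋂ n ∈ Set.Ici 1, hole (K n) := hlim ▸ ⟨i, rfl⟩
    exact Set.mem_iInter₂.1 this n hn
  -- Once the `k` prefixes are distinct they exhaust `K n`, which has exactly `k` words.
  have hword : ∀ᶠ n in atTop, wordList (K n) =
      Set.range fun i => List.ofFn (prefixWord n (x i)) := by
    filter_upwards [eventually_injective_prefixWord hx, eventually_ge_atTop 1] with n hinj hn
    have himg : Finset.univ.image (fun i => prefixWord n (x i)) = K n := by
      refine Finset.eq_of_subset_of_card_le ?_ ?_
      · rw [Finset.image_subset_iff]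
        exact fun i _ => hmem n hn i
      · rw [Finset.card_image_of_injective _ hinj, hcard n hn, Finset.card_fin]
    rw [wordList, ← himg, Finset.coe_image, Finset.coe_univ, Set.image_univ, ← Set.range_comp]
    rfl
  have hgap := tendsto_pow_mul_log_sub hN1
    ((eventually_ge_atTop 1).mono fun n hn => (hlam n hn).pos)
    (tendsto_pow_mul_sub hk hkN hx (lam := lam) (by
      filter_upwards [hword, eventually_ge_atTop 1] with n h hn
      exact h ▸ hlam n hn))
  have hfinal : Tendsto (fun n : ℕ => (Real.log N - Real.log (lam n)) / ((k : ℝ) / (N : ℝ) ^ n))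
      atTop (𝓝 ((∑ i, ∑ j, (limitCorrelation x (N : ℝ))⁻¹ i j) / ((k : ℝ) * (N : ℝ)))) := by
    have h := hgap.div_const (k : ℝ)
    rw [div_div, mul_comm (N : ℝ)] at h
    refine h.congr fun n => ?_
    field_simp
  refine ⟨limitCorrelation x (N : ℝ), ?_, isUnit_limitCorrelation hk hkN hx,
    ⟨fun n => Real.log N - Real.log (lam n),
      fun n hn => hasEscapeRate_of_hasGrowth hn (hlam n hn), ?_⟩,
    Real.log N, fun n => Real.log (lam n), hasEntropy_univ N,
    fun n hn => hasEntropy_perturbation (hcard' n hn) (hlam n hn), hfinal⟩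
  · refine tendsto_correlationMatrix x hN1 (z := fun _ => (N : ℝ)) (Eventually.of_forall fun n => ?_)
    rw [div_self (by positivity), sub_self, abs_zero]
    positivity
  · refine hfinal.congr' ?_
    filter_upwards [eventually_ge_atTop 1] with n hn
    rw [hole, uniformMeasure_prefixWord_mem, hcard n hn]
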